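/- Let $B$ be a real F-space (a real topological vector space whose topology is given by a complete translation-invariant metric), let $X$ be a $B$-valued (Borel measurable) random vector with law $\mu$, defined on a probability space $(\Omega,\mathcal F,P)$, and let $X_1,X_2,\ldots$ be i.i.d. copies of $X$ on the same space. Put $\mu_n=\frac1n\sum_{j=1}^n\delta_{X_j}$. For a class $\mathcal{T}$ of Borel functionals on a space $E$, a point $a\in E$ and a probability measure $\nu$ on $E$, the half space depth is $$HD_{\mathcal T}(a,\nu)=\inf_{\tau\in\mathcal T}\nu(\{x:\tau(x)\ge \tau(a)\});$$ $HD_{\mathbb R^d}$ denotes this depth when $E=\mathbb R^d$ and $\mathcal T$ is the set of all linear functionals on $\mathbb R^d$. Let $t_k:B\to\mathbb R$, $k\ge1$, be Borel functionals such that $\{t_k(X):k\ge 1\}$ are independent with mean zero and variances $\sigma_k^2\in(0,\infty)$ (with $\sigma_k>0$), and such that $$\liminf_{k\to\infty}P(t_k(X)<c_k)>0\quad\text{for all real sequences } (c_k) \text{ with } \lim_{k\to\infty} c_k/\sigma_k=0.$$ Let $\mathcal T$ be the set of all finite linear combinations of $\{t_k:k\ge1\}$, and let $a\in B$. Assume that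 either both (A-I) and (A-II), or (A-III), hold, where: (A-I) for all integers $d\ge1$, $HD_{\mathbb R^d}(\Pi_d(a),\mu^{\Pi_d})>0$, where $\Pi_d=(t_1,\ldots,t_d)$ and $\mu^{\Pi_d}$ is the image of $\mu$ under $\Pi_d$; (A-II) for some constant $c<\infty$, $\mathbb E(t_k^4(X))\le c\,[\mathbb E(t_k^2(X))]^2$ for all $k\ge1$; (A-III) for some $0<\lambda_k<\infty$, the variables $\{t_k(X)/\lambda_k:k\ge1\}$ are i.i.d. with a probability density $\phi$ that is positive almost everywhere and absolutely continuous on every compact interval of $\mathbb{R}$, with $\int_{\mathbb R}\frac{(\phi'(x))^2}{\phi(x)}\,dx<\infty$ and $\int_{\mathbb R}x^2\phi(x)\,dx<\infty$. Then: (i) if $\sum_{k\ge1}t_k^2(a)/\sigma_k^2<\infty$, then with probability one $HD_{\mathcal T}(a,\mu_n)=0$ for all $n\ge1$, while $HD_{\mathcal T}(a,\mu)>0$; hence consistency fails at $a$: with probability one $HD_{\mathcal T}(a,\mu_n)$ does not converge to $HD_{\mathcal T}(a,\mu)$; (ii) if $\sum_{k\ge1}t_k^2(a)/\sigma_k^2=\infty$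 but $\lim_{k\to\infty}t_k(a)/\sigma_k=0$, then consistency holds at $a$: with probability one $HD_{\mathcal T}(a,\mu_n)\to HD_{\mathcal T}(a,\mu)$ as $n\to\infty$. -/

import Mathlib

open MeasureTheory ProbabilityTheory Filter Topology
open scoped ENNReal

namespace HalfSpaceDepth

noncomputable section

/-- The half space depth of `a` with respect to the class of functionals `T` and the
measure `μ`: the infimum over `τ ∈ T` of `μ {x | τ x ≥ τ a}`. -/
def depth {E : Type*} [MeasurableSpace E] (T : Set (E → ℝ)) (a : E) (μ : Measure E) : ℝ≥0∞ :=
  ⨅ τ ∈ T, μ {x | τ a ≤ τ x}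

/-- The empirical measure `(1 / n) * ∑ δ_{Y j}` of the first `n` sample points. -/
def empiricalMeasure {E : Type*} [MeasurableSpace E] (Y : ℕ → E) (n : ℕ) : Measure E :=
  (n : ℝ≥0∞)⁻¹ • ∑ j ∈ Finset.range n, Measure.dirac (Y j)

/-- All finite linear combinations `∑ k, α k * t k` of the functionals `t k`. -/
def finiteCombinations {E : Type*} (t : ℕ → E → ℝ) : Set (E → ℝ) :=
  Set.range fun (α : ℕ →₀ ℝ) (x : E) => α.sum fun k r => r * t k x

/-- All linear functionals on `ℝ^d`; with `depth` they give the Tukey half space depth. -/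
def linearFunctionals (d : ℕ) : Set ((Fin d → ℝ) → ℝ) :=
  Set.range fun (L : (Fin d → ℝ) →ₗ[ℝ] ℝ) (x : Fin d → ℝ) => L x

/-- The map `x ↦ (t 0 x, …, t (d - 1) x)` into `ℝ^d`. -/
def firstCoords {E : Type*} (t : ℕ → E → ℝ) (d : ℕ) (x : E) : Fin d → ℝ :=
  fun i => t i x

/-- Assumption (A-I) at the point `a`: for every `d ≥ 1`, the image of `a` in `ℝ^d` has
positive Tukey half space depth with respect to the image of `μ` on `ℝ^d`. -/
def AssumptionI {E : Type*} [MeasurableSpace E] (t : ℕ → E → ℝ) (μ : Measure E) (a : E) : Prop :=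
  ∀ d : ℕ, 1 ≤ d →
    0 < depth (linearFunctionals d) (firstCoords t d a) (μ.map (firstCoords t d))

/-- Assumption (A-II) for a sequence of real random variables: uniformly bounded kurtosis,
`E (ξ k) ^ 4 ≤ c * (E (ξ k) ^ 2) ^ 2` with finite fourth moments. -/
def AssumptionII {Ω : Type*} [MeasurableSpace Ω] (ξ : ℕ → Ω → ℝ) (P : Measure Ω) : Prop :=
  ∃ c : ℝ, ∀ k, Integrable (fun ω => ξ k ω ^ 4) P ∧
    ∫ ω, ξ k ω ^ 4 ∂P ≤ c * (∫ ω, ξ k ω ^ 2 ∂P) ^ 2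

/-- Assumption (A-III) for a sequence of real random variables: for some scalings `lam k > 0` the
`ξ k / lam k` are i.i.d. with a probability density `φ` that is a.e. positive, absolutely
continuous on compact intervals, and has finite Fisher information and finite second moment. -/
def AssumptionIII {Ω : Type*} [MeasurableSpace Ω] (ξ : ℕ → Ω → ℝ) (P : Measure Ω) : Prop :=
  ∃ (lam : ℕ → ℝ) (φ : ℝ → ℝ),
    (∀ k, 0 < lam k) ∧
    iIndepFun (fun k ω => ξ k ω / lam k) P ∧
    (∀ k, P.map (fun ω => ξ k ω / lam k) = volume.withDensity fun x => ENNReal.ofReal (φ x)) ∧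
    (∀ᵐ x : ℝ, 0 < φ x) ∧
    (∀ a b : ℝ, AbsolutelyContinuousOnInterval φ a b) ∧
    Integrable (fun x : ℝ => deriv φ x ^ 2 / φ x) ∧
    Integrable (fun x : ℝ => x ^ 2 * φ x)

end

end HalfSpaceDepth

/-! The `liminf` condition, applied to sequences `c k < 0` with `c k / σ k → 0` slowly, yields
`δ > 0` such that `t k < -δ σ k` has probability at least `δ`, hence `E|t k| ≥ δ² σ k`, for all
large `k`. For independent centered variables, testing `∑ X k` against a Riesz product gives
`(∑ (E|X k|)²)^{1/2} ≤ 4 E|∑ X k|`; with a one-sided Paley–Zygmund inequality, every linear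
combination of the `t k` with `k ≥ d` exceeds a fixed multiple of its standard deviation with
probability bounded below. If `∑ t k(a)² / σ k²` converges, Cauchy–Schwarz puts the value at `a` of
such a combination below that threshold once `d` is large, and (A-I), which (A-III) implies, handles
the first `d` functionals; so the population depth is positive. If the series diverges, Chebyshev's
inequality makes the population depth zero.

The empirical depth vanishes almost surely when `t k(a) / σ k → 0`: for each `n` the events that the
whole sample lies in `{t k < t k(a)}` are independent in `k` with probabilities bounded below, so by
the second Borel–Cantelli lemma one of them occurs. -/

namespace HalfSpaceDepth

section Anticoncentration

variable {Ω : Type*} [MeasurableSpace Ω] {P : Measure Ω}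

lemma integral_posPart_of_integral_eq_zero {S : Ω → ℝ} (hS : Integrable S P)
    (h0 : ∫ ω, S ω ∂P = 0) : ∫ ω, (S ω)⁺ ∂P = (∫ ω, |S ω| ∂P) / 2 := by
  rw [integral_abs_eq_two_mul_integral_posPart_sub_integral hS, h0]
  ring

lemma sq_setIntegral_le [IsFiniteMeasure P] {S : Ω → ℝ} (hS : MemLp S 2 P) {A : Set Ω}
    (hA : MeasurableSet A) : (∫ ω in A, S ω ∂P) ^ 2 ≤ (∫ ω, S ω ^ 2 ∂P) * P.real A := by
  have hquad : ∀ r : ℝ,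
      0 ≤ P.real A * (r * r) + (-2 * ∫ ω in A, S ω ∂P) * r + ∫ ω, S ω ^ 2 ∂P := by
    intro r
    have hint : Integrable (A.indicator fun ω => r * r - 2 * r * S ω) P :=
      ((integrable_const _).sub ((hS.integrable one_le_two).const_mul _)).indicator hA
    have hexpand : ∀ ω, (A.indicator (fun _ => r) ω - S ω) ^ 2 =
        A.indicator (fun ω => r * r - 2 * r * S ω) ω + S ω ^ 2 := by
      intro ω
      by_cases hω : ω ∈ A <;> simp only [Set.indicator_of_mem, Set.indicator_of_notMem, hω,
        not_false_eq_true] <;> ring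
    calc 0 ≤ ∫ ω, (A.indicator (fun _ => r) ω - S ω) ^ 2 ∂P := integral_nonneg fun _ => sq_nonneg _
      _ = ∫ ω in A, (r * r - 2 * r * S ω) ∂P + ∫ ω, S ω ^ 2 ∂P := by
        simp only [hexpand]
        rw [integral_add hint hS.integrable_sq, integral_indicator hA]
      _ = _ := by
        rw [integral_sub (integrable_const _)
          ((hS.integrable one_le_two).integrableOn.const_mul _), setIntegral_const,
          integral_const_mul, smul_eq_mul]
        ring
  have := discrim_le_zero hquad
  rw [discrim] at this
  linarith

-- A one-sided Paley–Zygmund inequality: centering puts half of the first absolute moment on the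
-- positive side, and at most half of that can come from values below `E|S| / 4`.
lemma sq_integral_abs_le_mul_measureReal [IsProbabilityMeasure P] {S : Ω → ℝ} (hS : Measurable S)
    (hS2 : MemLp S 2 P) (h0 : ∫ ω, S ω ∂P = 0) :
    ((∫ ω, |S ω| ∂P) / 4) ^ 2 ≤
      (∫ ω, S ω ^ 2 ∂P) * P.real {ω | (∫ ω, |S ω| ∂P) / 4 ≤ S ω} := by
  set m : ℝ := ∫ ω, |S ω| ∂P
  have hm : 0 ≤ m := integral_nonneg fun _ => abs_nonneg _
  have hint : Integrable S P := hS2.integrable one_le_two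
  have hA : MeasurableSet {ω | m / 4 ≤ S ω} := measurableSet_le measurable_const hS
  have hpos : ∀ ω, (S ω)⁺ ≤ m / 4 + {ω | m / 4 ≤ S ω}.indicator S ω := by
    intro ω
    by_cases hω : m / 4 ≤ S ω
    · rw [Set.indicator_of_mem (by exact hω), posPart_eq_self.2 (by linarith)]
      linarith
    · rw [Set.indicator_of_notMem (by exact hω), add_zero]
      exact sup_le (le_of_not_ge hω) (by positivity)
  have hhalf : m / 2 ≤ m / 4 + ∫ ω in {ω | m / 4 ≤ S ω}, S ω ∂P := by
    rw [← integral_posPart_of_integral_eq_zero hint h0]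
    refine (integral_mono hint.pos_part ((integrable_const _).add (hint.indicator hA))
      hpos).trans ?_
    rw [integral_add' (integrable_const _) (hint.indicator hA), integral_indicator hA,
      integral_const, probReal_univ, one_smul]
  calc (m / 4) ^ 2 ≤ (∫ ω in {ω | m / 4 ≤ S ω}, S ω ∂P) ^ 2 := by gcongr; linarith
    _ ≤ _ := sq_setIntegral_le hS2 hA

lemma sq_le_measureReal_ge_of_mul_sqrt_variance_le [IsProbabilityMeasure P] {S : Ω → ℝ}
    (hS : Measurable S) (hS2 : MemLp S 2 P) (h0 : ∫ ω, S ω ∂P = 0) {c : ℝ} (hc0 : 0 ≤ c)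
    (hc1 : c ≤ 1) (hc : c * √(variance S P) ≤ ∫ ω, |S ω| ∂P) :
    (c / 4) ^ 2 ≤ P.real {ω | c / 4 * √(variance S P) ≤ S ω} := by
  rcases (variance_nonneg S P).eq_or_lt with hv | hv
  · have hS_ae : ∀ᵐ ω ∂P, S ω = 0 := by
      simpa only [h0] using ae_eq_integral_of_variance_eq_zero hS2 hv.symm
    have hone : P.real {ω | c / 4 * √(variance S P) ≤ S ω} = 1 := by
      rw [← probReal_univ (μ := P)]
      refine measureReal_congr ?_
      filter_upwards [hS_ae] with ω hω
      refine eq_true (?_ : c / 4 * √(variance S P) ≤ S ω)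
      rw [hω, ← hv, Real.sqrt_zero, mul_zero]
    rw [hone]
    exact pow_le_one₀ (by positivity) (by linarith)
  · have hPZ := sq_integral_abs_le_mul_measureReal hS hS2 h0
    rw [← variance_of_integral_eq_zero hS.aemeasurable h0] at hPZ
    have hmono : P.real {ω | (∫ ω, |S ω| ∂P) / 4 ≤ S ω} ≤
        P.real {ω | c / 4 * √(variance S P) ≤ S ω} :=
      measureReal_mono fun ω hω => (by linarith : _ ≤ _).trans (Set.mem_ofPred.1 hω)
    refine le_of_mul_le_mul_left ?_ hv
    calc variance S P * (c / 4) ^ 2 = (c * √(variance S P) / 4) ^ 2 := by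
          linear_combination (-(c / 4) ^ 2) * Real.sq_sqrt hv.le
      _ ≤ ((∫ ω, |S ω| ∂P) / 4) ^ 2 := by gcongr
      _ ≤ _ := hPZ.trans (mul_le_mul_of_nonneg_left hmono hv.le)

lemma exists_centered_integral_mul_eq [IsProbabilityMeasure P] {S : Ω → ℝ} (hS : Measurable S)
    (hint : Integrable S P) (h0 : ∫ ω, S ω ∂P = 0) :
    ∃ g : ℝ → ℝ, Measurable g ∧ (∀ x, |g x| ≤ 1) ∧ ∫ ω, g (S ω) ∂P = 0 ∧
      ∫ ω, S ω * g (S ω) ∂P = (∫ ω, |S ω| ∂P) / 2 := by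
  have hA : MeasurableSet {ω | 0 ≤ S ω} := measurableSet_le measurable_const hS
  set p : ℝ := P.real {ω | 0 ≤ S ω}
  refine ⟨fun x => (Set.Ici 0).indicator 1 x - p,
    (measurable_one.indicator measurableSet_Ici).sub_const p, fun x => ?_, ?_, ?_⟩
  · have hp0 : 0 ≤ p := measureReal_nonneg
    have hp1 : p ≤ 1 := measureReal_le_one
    rw [abs_le]
    by_cases hx : x ∈ Set.Ici 0 <;> simp only [Set.indicator_of_mem, Set.indicator_of_notMem, hx,
      Pi.one_apply, not_false_eq_true] <;> constructor <;> linarith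
  · have hind : ∀ ω, (Set.Ici (0 : ℝ)).indicator (1 : ℝ → ℝ) (S ω) =
        {ω | 0 ≤ S ω}.indicator 1 ω := fun _ => rfl
    simp only [hind]
    rw [integral_sub ((integrable_const 1).indicator hA) (integrable_const _),
      integral_indicator_one hA, integral_const, probReal_univ, one_smul, sub_self]
  · have hmul : ∀ ω, S ω * ((Set.Ici 0).indicator 1 (S ω) - p) = (S ω)⁺ - S ω * p := by
      intro ω
      rcases le_or_gt 0 (S ω) with hω | hω
      · rw [Set.indicator_of_mem (Set.mem_Ici.2 hω), posPart_eq_self.2 hω, Pi.one_apply]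
        ring
      · rw [Set.indicator_of_notMem (Set.notMem_Ici.2 hω), posPart_eq_zero.2 hω.le]
        ring
    have hposint : Integrable (fun ω => (S ω)⁺) P := hint.pos_part
    simp only [hmul]
    rw [integral_sub hposint (hint.mul_const p), integral_mul_const, h0, zero_mul, sub_zero,
      integral_posPart_of_integral_eq_zero hint h0]

lemma iIndepFun_const_mul {ι : Type*} {X : ι → Ω → ℝ} (hind : iIndepFun X P) (α : ι → ℝ) :
    iIndepFun (fun k ω => α k * X k ω) P :=
  hind.comp (fun k y => α k * y) fun k => measurable_const_mul (α k)

lemma variance_sum_of_iIndepFun {ι : Type*} {X : ι → Ω → ℝ} (hind : iIndepFun X P)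
    (hX2 : ∀ k, MemLp (X k) 2 P) (s : Finset ι) :
    variance (fun ω => ∑ k ∈ s, X k ω) P = ∑ k ∈ s, variance (X k) P := by
  rw [← IndepFun.variance_sum (fun k _ => hX2 k) fun i _ j _ hij => hind.indepFun hij]
  congr 1
  exact funext fun ω => (Finset.sum_apply ω s X).symm

variable {ι : Type*} [Fintype ι]

/-- The Riesz product `∏ (1 + i g_j(x_j))`, a test function that is bounded in terms of
`∑ ‖g_j‖²` although it correlates with each coordinate `x_j` as strongly as `g_j` does. -/
def rieszProduct (g : ι → ℝ → ℝ) (x : ι → ℝ) : ℂ :=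
  ∏ j, (1 + g j (x j) * Complex.I)

lemma norm_rieszProduct_le {g : ι → ℝ → ℝ} {β : ι → ℝ} (hg : ∀ j x, |g j x| ≤ β j) (x : ι → ℝ) :
    ‖rieszProduct g x‖ ≤ Real.exp ((∑ j, β j ^ 2) / 2) := by
  have hfactor : ∀ j, ‖(1 + g j (x j) * Complex.I : ℂ)‖ ≤ Real.exp (β j ^ 2 / 2) := by
    intro j
    have hsq : g j (x j) ^ 2 ≤ β j ^ 2 := sq_le_sq' (abs_le.1 (hg j _)).1 (abs_le.1 (hg j _)).2
    have hnorm := Complex.norm_add_mul_I 1 (g j (x j))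
    rw [Complex.ofReal_one] at hnorm
    rw [hnorm, Real.exp_half]
    apply Real.sqrt_le_sqrt
    linarith [Real.add_one_le_exp (β j ^ 2)]
  rw [rieszProduct, norm_prod, Finset.sum_div, Real.exp_sum]
  exact Finset.prod_le_prod (fun _ _ => norm_nonneg _) fun j _ => hfactor j

lemma measurable_rieszProduct {g : ι → ℝ → ℝ} (hg : ∀ j, Measurable (g j)) :
    Measurable (rieszProduct g) := by
  unfold rieszProduct
  fun_prop

variable {X : ι → Ω → ℝ}

lemma integral_mul_rieszProduct (hX : ∀ k, Measurable (X k)) (hind : iIndepFun X P)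
    (hint : ∀ k, Integrable (X k) P) (h0 : ∀ k, ∫ ω, X k ω ∂P = 0) {g : ι → ℝ → ℝ}
    (hg : ∀ k, Measurable (g k)) {β : ι → ℝ} (hgβ : ∀ k x, |g k x| ≤ β k)
    (hg0 : ∀ k, ∫ ω, g k (X k ω) ∂P = 0) (k : ι) :
    ∫ ω, X k ω * rieszProduct g (X · ω) ∂P = (∫ ω, X k ω * g k (X k ω) ∂P : ℝ) * Complex.I := by
  classical
  have := hind.isProbabilityMeasure
  have hgint : ∀ j, Integrable (fun ω => g j (X j ω)) P := fun j =>
    .of_bound ((hg j).comp (hX j)).aestronglyMeasurable (β j) (ae_of_all _ fun ω => hgβ j _)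
  have hsplit : ∀ ω, X k ω * rieszProduct g (X · ω) =
      ∏ j, (if j = k then (X j ω : ℂ) else 1) * (1 + g j (X j ω) * Complex.I) := by
    intro ω
    rw [Finset.prod_mul_distrib, Finset.prod_ite_eq' Finset.univ k, if_pos (Finset.mem_univ k),
      rieszProduct]
  have hfactor : ∀ j, ∫ ω, (if j = k then (X j ω : ℂ) else 1) * (1 + g j (X j ω) * Complex.I) ∂P =
      if j = k then (∫ ω, X j ω * g j (X j ω) ∂P : ℝ) * Complex.I else 1 := by
    intro j
    split_ifs
    · have hXg : Integrable (fun ω => X j ω * g j (X j ω)) P :=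
        (hint j).mul_bdd (c := β j) (hgint j).1 (ae_of_all _ fun ω => hgβ j _)
      have hexpand : ∀ ω, (X j ω : ℂ) * (1 + g j (X j ω) * Complex.I) =
          (X j ω : ℝ) + ((X j ω * g j (X j ω) : ℝ) : ℂ) * Complex.I := fun ω => by
        push_cast; ring
      simp only [hexpand]
      rw [integral_add (hint j).ofReal (hXg.ofReal.mul_const _), integral_mul_const,
        integral_complex_ofReal, integral_complex_ofReal, h0, Complex.ofReal_zero, zero_add]
    · simp only [one_mul]
      rw [integral_add (integrable_const _) ((hgint j).ofReal.mul_const _), integral_mul_const,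
        integral_complex_ofReal, hg0, integral_const, probReal_univ]
      simp
  simp only [hsplit]
  rw [hind.integral_fun_prod_comp
    (f := fun j (x : ℝ) => (if j = k then (x : ℂ) else 1) * (1 + g j x * Complex.I))
    (fun j => (hX j).aemeasurable) fun j => Measurable.aestronglyMeasurable
      (Measurable.mul (by split_ifs <;> fun_prop) (by fun_prop))]
  simp only [hfactor]
  rw [Finset.prod_ite_eq' Finset.univ k, if_pos (Finset.mem_univ k)]

lemma sum_integral_mul_le_exp_mul_integral_abs_sum (hX : ∀ k, Measurable (X k))
    (hind : iIndepFun X P) (hint : ∀ k, Integrable (X k) P) (h0 : ∀ k, ∫ ω, X k ω ∂P = 0)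
    {g : ι → ℝ → ℝ} (hg : ∀ k, Measurable (g k)) {β : ι → ℝ} (hgβ : ∀ k x, |g k x| ≤ β k)
    (hg0 : ∀ k, ∫ ω, g k (X k ω) ∂P = 0) :
    ∑ k, ∫ ω, X k ω * g k (X k ω) ∂P ≤
      Real.exp ((∑ k, β k ^ 2) / 2) * ∫ ω, |∑ k, X k ω| ∂P := by
  have hRm : AEStronglyMeasurable (fun ω => rieszProduct g (X · ω)) P :=
    ((measurable_rieszProduct hg).comp (measurable_pi_lambda _ hX)).aestronglyMeasurable
  have hXR : ∀ k, Integrable (fun ω => X k ω * rieszProduct g (X · ω)) P := fun k =>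
    (hint k).ofReal.mul_bdd hRm (ae_of_all _ fun ω => norm_rieszProduct_le hgβ _)
  have hpairing : ∫ ω, ((∑ k, X k ω : ℝ) : ℂ) * rieszProduct g (X · ω) ∂P =
      (∑ k, ∫ ω, X k ω * g k (X k ω) ∂P : ℝ) * Complex.I := by
    simp only [Complex.ofReal_sum, Finset.sum_mul]
    rw [integral_finsetSum _ fun k _ => hXR k]
    exact Finset.sum_congr rfl fun k _ => integral_mul_rieszProduct hX hind hint h0 hg hgβ hg0 k
  calc ∑ k, ∫ ω, X k ω * g k (X k ω) ∂P
      ≤ ‖((∑ k, ∫ ω, X k ω * g k (X k ω) ∂P : ℝ) : ℂ) * Complex.I‖ := by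
        rw [norm_mul, Complex.norm_I, mul_one, Complex.norm_real]
        exact le_abs_self _
    _ ≤ ∫ ω, Real.exp ((∑ k, β k ^ 2) / 2) * |∑ k, X k ω| ∂P := by
        rw [← hpairing]
        refine norm_integral_le_of_norm_le
          ((integrable_finsetSum _ fun k _ => hint k).abs.const_mul _) (ae_of_all _ fun ω => ?_)
        rw [norm_mul, Complex.norm_real, mul_comm, Real.norm_eq_abs]
        gcongr
        exact norm_rieszProduct_le hgβ _
    _ = _ := integral_const_mul _ _

lemma sqrt_sum_sq_integral_abs_le (hX : ∀ k, Measurable (X k)) (hind : iIndepFun X P)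
    (hint : ∀ k, Integrable (X k) P) (h0 : ∀ k, ∫ ω, X k ω ∂P = 0) :
    √(∑ k, (∫ ω, |X k ω| ∂P) ^ 2) ≤ 4 * ∫ ω, |∑ k, X k ω| ∂P := by
  have := hind.isProbabilityMeasure
  set m : ι → ℝ := fun k => ∫ ω, |X k ω| ∂P
  have hm : ∀ k, 0 ≤ m k := fun k => integral_nonneg fun _ => abs_nonneg _
  set r : ℝ := √(∑ k, m k ^ 2)
  have hr2 : r ^ 2 = ∑ k, m k ^ 2 := Real.sq_sqrt (Finset.sum_nonneg fun k _ => sq_nonneg _)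
  have hr0 : 0 ≤ r := Real.sqrt_nonneg _
  rcases hr0.eq_or_lt with hr | hr
  · rw [← hr]
    positivity
  choose g hg hg1 hg0 hXg using fun k => exists_centered_integral_mul_eq (hX k) (hint k) (h0 k)
  have hriesz := sum_integral_mul_le_exp_mul_integral_abs_sum hX hind hint h0
    (g := fun k x => m k / r * g k x) (β := fun k => m k / r) (fun k => (hg k).const_mul _)
    (fun k x => by
      rw [abs_mul, abs_of_nonneg (div_nonneg (hm k) hr.le)]
      exact mul_le_of_le_one_right (div_nonneg (hm k) hr.le) (hg1 k x))
    (fun k => by rw [integral_const_mul, hg0, mul_zero])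
  have hβ : ∑ k, (m k / r) ^ 2 = 1 := by
    simp only [div_pow]
    rw [← Finset.sum_div, ← hr2, div_self (by positivity)]
  have hpairing : ∑ k, ∫ ω, X k ω * (m k / r * g k (X k ω)) ∂P = r / 2 := by
    have hterm : ∀ k, ∫ ω, X k ω * (m k / r * g k (X k ω)) ∂P = m k ^ 2 / (2 * r) := fun k => by
      simp only [mul_left_comm _ (m k / r)]
      rw [integral_const_mul, hXg, div_mul_div_comm, sq, mul_comm 2 r]
    simp only [hterm]
    rw [← Finset.sum_div, ← hr2]
    field_simp
  have hexp : Real.exp (1 / 2) ≤ 2 := by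
    rw [Real.exp_half]
    exact Real.sqrt_le_iff.2 ⟨zero_le_two, by linarith [Real.exp_one_lt_d9]⟩
  rw [hβ, hpairing] at hriesz
  have hS : 0 ≤ ∫ ω, |∑ k, X k ω| ∂P := integral_nonneg fun _ => abs_nonneg _
  nlinarith

lemma mul_sqrt_sum_variance_le_integral_abs_sum (hX : ∀ k, Measurable (X k)) (hind : iIndepFun X P)
    (hX2 : ∀ k, MemLp (X k) 2 P) (h0 : ∀ k, ∫ ω, X k ω ∂P = 0) {c : ℝ} (hc0 : 0 ≤ c)
    (hc : ∀ k, c ^ 2 * variance (X k) P ≤ (∫ ω, |X k ω| ∂P) ^ 2) :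
    c / 4 * √(∑ k, variance (X k) P) ≤ ∫ ω, |∑ k, X k ω| ∂P := by
  have := hind.isProbabilityMeasure
  have hcv : c * √(∑ k, variance (X k) P) ≤ √(∑ k, (∫ ω, |X k ω| ∂P) ^ 2) := by
    rw [← Real.sqrt_sq hc0, ← Real.sqrt_mul (sq_nonneg c), Finset.mul_sum]
    exact Real.sqrt_le_sqrt (Finset.sum_le_sum fun k _ => hc k)
  linarith [sqrt_sum_sq_integral_abs_le hX hind (fun k => (hX2 k).integrable one_le_two) h0]

lemma sq_le_measureReal_sum_ge (hX : ∀ k, Measurable (X k)) (hind : iIndepFun X P)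
    (hX2 : ∀ k, MemLp (X k) 2 P) (h0 : ∀ k, ∫ ω, X k ω ∂P = 0) {c : ℝ} (hc0 : 0 ≤ c) (hc1 : c ≤ 1)
    (hc : ∀ k, c ^ 2 * variance (X k) P ≤ (∫ ω, |X k ω| ∂P) ^ 2) :
    (c / 16) ^ 2 ≤ P.real {ω | c / 16 * √(∑ k, variance (X k) P) ≤ ∑ k, X k ω} := by
  have := hind.isProbabilityMeasure
  have hS0 : ∫ ω, ∑ k, X k ω ∂P = 0 := by
    rw [integral_finsetSum _ fun k _ => (hX2 k).integrable one_le_two]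
    exact Finset.sum_eq_zero fun k _ => h0 k
  have hL1 := mul_sqrt_sum_variance_le_integral_abs_sum hX hind hX2 h0 hc0 hc
  rw [← variance_sum_of_iIndepFun hind hX2 Finset.univ] at hL1 ⊢
  have := sq_le_measureReal_ge_of_mul_sqrt_variance_le (Finset.measurable_sum _ fun k _ => hX k)
    (memLp_finsetSum _ fun k _ => hX2 k) hS0 (by positivity) (by linarith) hL1
  rwa [div_div, show (4 * 4 : ℝ) = 16 by norm_num] at this

end Anticoncentration

section LimInf

lemma exists_eventually_le_of_forall_liminf_pos {E : Type*} [TopologicalSpace E] {x₀ : E}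
    {f : ℕ → E → ℝ≥0∞}
    (h : ∀ c : ℕ → E, Tendsto c atTop (𝓝 x₀) → 0 < liminf (fun k => f k (c k)) atTop)
    {u : ℕ → E} (hu : Tendsto u atTop (𝓝 x₀)) {v : ℕ → ℝ≥0∞} (hv : Tendsto v atTop (𝓝 0)) :
    ∃ n, ∀ᶠ k in atTop, v n ≤ f k (u n) := by
  by_contra! hcon
  obtain ⟨φ, hφ, hlt⟩ := extraction_forall_of_frequently hcon
  have hc : Tendsto (Function.extend φ u fun _ => x₀) atTop (𝓝 x₀) := by
    refine tendsto_def.2 fun U hU => ?_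
    obtain ⟨N, hN⟩ := eventually_atTop.1 (hu hU)
    filter_upwards [eventually_ge_atTop (φ N)] with k hk
    by_cases hkφ : ∃ n, φ n = k
    · obtain ⟨n, rfl⟩ := hkφ
      rw [Set.mem_preimage, hφ.injective.extend_apply]
      exact hN n (hφ.le_iff_le.1 hk)
    · rw [Set.mem_preimage, Function.extend_apply' _ _ _ hkφ]
      exact mem_of_mem_nhds hU
  obtain ⟨ε, hε0, hε⟩ := exists_between (h _ hc)
  have hge : ∀ᶠ n in atTop, ε ≤ v n := by
    filter_upwards [hφ.tendsto_atTop.eventually (eventually_lt_of_lt_liminf hε)] with n hn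
    rw [hφ.injective.extend_apply] at hn
    exact (hn.trans (hlt n)).le
  exact hε0.not_ge (ge_of_tendsto hv hge)

variable {Ω : Type*} [MeasurableSpace Ω] {P : Measure Ω} [IsFiniteMeasure P] {ξ : ℕ → Ω → ℝ}
  {σ : ℕ → ℝ}

lemma exists_eventually_le_measure_lt_of_liminf_pos (hσ : ∀ k, 0 < σ k)
    (hliminf : ∀ c : ℕ → ℝ, Tendsto (fun k => c k / σ k) atTop (𝓝 0) →
      0 < liminf (fun k => P {ω | ξ k ω < c k}) atTop) :
    ∃ δ : ℝ, 0 < δ ∧ δ ≤ 1 ∧ ∀ᶠ k in atTop, δ ≤ P.real {ω | ξ k ω < -δ * σ k} := by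
  have hu : Tendsto (fun n : ℕ => 1 / ((n : ℝ) + 1)) atTop (𝓝 0) :=
    tendsto_one_div_add_atTop_nhds_zero_nat
  obtain ⟨n, hn⟩ := exists_eventually_le_of_forall_liminf_pos
    (f := fun k x => P {ω | ξ k ω < x * σ k})
    (fun c hc => hliminf _ (by simpa only [mul_div_cancel_right₀ _ (hσ _).ne'] using hc))
    (by simpa only [neg_zero] using hu.neg)
    (by simpa only [ENNReal.ofReal_zero] using ENNReal.tendsto_ofReal hu)
  refine ⟨1 / ((n : ℝ) + 1), by positivity,
    div_le_one_of_le₀ (le_add_of_nonneg_left n.cast_nonneg) (by positivity), hn.mono fun k hk => ?_⟩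
  exact (ENNReal.ofReal_le_iff_le_toReal (measure_ne_top _ _)).1 hk

lemma exists_eventually_mul_le_integral_abs_of_liminf_pos (hξ : ∀ k, Integrable (ξ k) P)
    (hσ : ∀ k, 0 < σ k)
    (hliminf : ∀ c : ℕ → ℝ, Tendsto (fun k => c k / σ k) atTop (𝓝 0) →
      0 < liminf (fun k => P {ω | ξ k ω < c k}) atTop) :
    ∃ c : ℝ, 0 < c ∧ c ≤ 1 ∧ ∀ᶠ k in atTop, c * σ k ≤ ∫ ω, |ξ k ω| ∂P := by
  obtain ⟨δ, hδ0, hδ1, hδ⟩ := exists_eventually_le_measure_lt_of_liminf_pos hσ hliminf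
  refine ⟨δ ^ 2, by positivity, pow_le_one₀ hδ0.le hδ1, hδ.mono fun k hk => ?_⟩
  have hδσ : 0 ≤ δ * σ k := (mul_pos hδ0 (hσ k)).le
  have habs : {ω | ξ k ω < -δ * σ k} ⊆ {ω | δ * σ k ≤ |ξ k ω|} := fun ω hω =>
    le_abs.2 (Or.inr (le_neg_of_le_neg (neg_mul δ (σ k) ▸ (Set.mem_ofPred.1 hω).le)))
  calc δ ^ 2 * σ k = δ * σ k * δ := by ring
    _ ≤ δ * σ k * P.real {ω | δ * σ k ≤ |ξ k ω|} :=
        mul_le_mul_of_nonneg_left (hk.trans (measureReal_mono habs)) hδσ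
    _ ≤ ∫ ω, |ξ k ω| ∂P :=
        mul_meas_ge_le_integral_of_nonneg (ae_of_all _ fun _ => abs_nonneg _) (hξ k).abs _

end LimInf

section Depth

variable {E : Type*} {t : ℕ → E → ℝ}

lemma sum_mem_finiteCombinations (t : ℕ → E → ℝ) (s : Finset ℕ) (α : ℕ → ℝ) :
    (fun x => ∑ k ∈ s, α k * t k x) ∈ finiteCombinations t := by
  classical
  refine ⟨Finsupp.onFinset s (fun k => if k ∈ s then α k else 0) fun k hk => ?_, ?_⟩
  · by_contra hks
    exact hk (if_neg hks)
  · ext x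
    refine (Finsupp.onFinset_sum _ fun _ => zero_mul _).trans ?_
    exact Finset.sum_congr rfl fun k hk => by rw [if_pos hk]

lemma mem_finiteCombinations (t : ℕ → E → ℝ) (k : ℕ) : t k ∈ finiteCombinations t := by
  simpa only [Finset.sum_singleton, one_mul] using
    sum_mem_finiteCombinations t {k} fun _ => 1

lemma exists_eq_sum_range_of_mem_finiteCombinations {τ : E → ℝ} (hτ : τ ∈ finiteCombinations t)
    (d : ℕ) : ∃ N ≥ d, ∃ α : ℕ → ℝ, τ = fun x => ∑ k ∈ Finset.range N, α k * t k x := by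
  obtain ⟨α, rfl⟩ := hτ
  obtain ⟨N, hN⟩ := α.support.exists_nat_subset_range
  refine ⟨max d N, le_max_left d N, α, funext fun x => ?_⟩
  refine Finsupp.sum_of_support_subset _ (hN.trans ?_) _ fun _ _ => zero_mul _
  exact Finset.range_mono (le_max_right d N)

variable [MeasurableSpace E]

lemma depth_empiricalMeasure_eq_zero {T : Set (E → ℝ)} {a : E} {τ : E → ℝ} (hτT : τ ∈ T)
    (hτ : Measurable τ) {Y : ℕ → E} {n : ℕ} (hY : ∀ j < n, τ (Y j) < τ a) :
    depth T a (empiricalMeasure Y n) = 0 := by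
  refine le_antisymm ((iInf₂_le τ hτT).trans_eq ?_) zero_le
  have hdirac : ∀ j ∈ Finset.range n, Measure.dirac (Y j) {x | τ a ≤ τ x} = 0 := fun j hj => by
    rw [Measure.dirac_apply' _ (measurableSet_le measurable_const hτ), Set.indicator_of_notMem]
    exact (hY j (Finset.mem_range.1 hj)).not_ge
  rw [empiricalMeasure, Measure.smul_apply, Measure.finsetSum_apply,
    Finset.sum_eq_zero hdirac, smul_zero]

lemma measurable_firstCoords (ht : ∀ k, Measurable (t k)) (d : ℕ) :
    Measurable (firstCoords t d) :=
  measurable_pi_lambda _ fun i => ht i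

lemma depth_linearFunctionals_map_firstCoords (ht : ∀ k, Measurable (t k)) (μ : Measure E)
    (a : E) (d : ℕ) :
    depth (linearFunctionals d) (firstCoords t d a) (μ.map (firstCoords t d)) =
      ⨅ α : Fin d → ℝ, μ {x | ∑ i, α i * t i a ≤ ∑ i, α i * t i x} := by
  rw [depth, linearFunctionals, iInf_range]
  refine (((Pi.basisFun ℝ (Fin d)).constr ℝ).toEquiv.iInf_congr fun α => ?_).symm
  have hα : ∀ x, (Pi.basisFun ℝ (Fin d)).constr ℝ α (firstCoords t d x) = ∑ i, α i * t i x := by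
    intro x
    simp only [Module.Basis.constr_apply_fintype, Pi.basisFun_equivFun, LinearEquiv.refl_apply,
      firstCoords, smul_eq_mul, mul_comm]
  rw [LinearEquiv.coe_toEquiv, Measure.map_apply (measurable_firstCoords ht d)
    (measurableSet_le measurable_const (LinearMap.continuous_of_finiteDimensional _).measurable)]
  simp only [Set.preimage_ofPred_eq, hα]

end Depth

section Assumptions

variable {E : Type*} [MeasurableSpace E] {μ : Measure E} {t : ℕ → E → ℝ} {a : E}

-- Lower bounding a sum termwise: each term only needs the half line singled out by its sign.
lemma prod_min_le_measure_sum_ge {ι : Type*} [Fintype ι] {Y : ι → E → ℝ} (hind : iIndepFun Y μ)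
    (α b : ι → ℝ) :
    ∏ i, min (μ {x | b i ≤ Y i x}) (μ {x | Y i x ≤ b i}) ≤
      μ {x | ∑ i, α i * b i ≤ ∑ i, α i * Y i x} := by
  have hm : ∀ i, MeasurableSet[MeasurableSpace.comap (Y i) inferInstance]
      {x | α i * b i ≤ α i * Y i x} := fun i =>
    ⟨{y | α i * b i ≤ α i * y}, measurableSet_le measurable_const (measurable_const_mul _), rfl⟩
  calc ∏ i, min (μ {x | b i ≤ Y i x}) (μ {x | Y i x ≤ b i})
      ≤ ∏ i, μ {x | α i * b i ≤ α i * Y i x} := by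
        refine Finset.prod_le_prod' fun i _ => ?_
        rcases le_total 0 (α i) with hα | hα
        · exact (min_le_left _ _).trans
            (measure_mono fun x hx => mul_le_mul_of_nonneg_left hx hα)
        · exact (min_le_right _ _).trans
            (measure_mono fun x hx => mul_le_mul_of_nonpos_left hx hα)
    _ = μ (⋂ i, {x | α i * b i ≤ α i * Y i x}) := (hind.meas_iInter hm).symm
    _ ≤ _ := measure_mono fun x hx =>
        Finset.sum_le_sum fun i _ => Set.mem_ofPred.1 (Set.mem_iInter.1 hx i)

lemma assumptionI_of_forall_measure_pos (ht : ∀ k, Measurable (t k)) (hind : iIndepFun t μ)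
    (hge : ∀ k, 0 < μ {x | t k a ≤ t k x}) (hle : ∀ k, 0 < μ {x | t k x ≤ t k a}) :
    AssumptionI t μ a := by
  intro d _
  rw [depth_linearFunctionals_map_firstCoords ht]
  refine lt_of_lt_of_le ?_ (le_iInf fun α => prod_min_le_measure_sum_ge
    (hind.precomp Fin.val_injective) α fun i : Fin d => t i a)
  exact CanonicallyOrderedAdd.prod_pos.2 fun i _ => lt_min (hge i) (hle i)

lemma AssumptionI.exists_le_measure_sum_range_ge (hI : AssumptionI t μ a)
    (ht : ∀ k, Measurable (t k)) {d : ℕ} (hd : 1 ≤ d) :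
    ∃ h : ℝ≥0∞, 0 < h ∧ ∀ α : ℕ → ℝ,
      h ≤ μ {x | ∑ k ∈ Finset.range d, α k * t k a ≤ ∑ k ∈ Finset.range d, α k * t k x} := by
  refine ⟨_, hI d hd, fun α => ?_⟩
  rw [depth_linearFunctionals_map_firstCoords ht]
  refine (iInf_le _ fun i : Fin d => α i).trans_eq ?_
  simp only [Finset.sum_range]

variable {Ω : Type*} [MeasurableSpace Ω] {P : Measure Ω}

lemma iIndepFun_map_of_comp {ι : Type*} {t : ι → E → ℝ} {X : Ω → E} (hX : Measurable X)
    (ht : ∀ k, Measurable (t k)) (hind : iIndepFun (fun k ω => t k (X ω)) P) :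
    iIndepFun t (P.map X) := by
  rw [iIndepFun_iff_measure_inter_preimage_eq_mul] at hind ⊢
  intro s A hA
  rw [Measure.map_apply hX (Finset.measurableSet_biInter _ fun k hk => ht k (hA k hk)),
    Set.preimage_iInter₂, Finset.prod_congr rfl fun k hk =>
      Measure.map_apply hX (ht k (hA k hk))]
  exact hind s hA

lemma continuous_of_absolutelyContinuousOnInterval {φ : ℝ → ℝ}
    (hφ : ∀ x y : ℝ, AbsolutelyContinuousOnInterval φ x y) : Continuous φ := by
  refine continuous_iff_continuousAt.2 fun x => (hφ (x - 1) (x + 1)).continuousOn.continuousAt ?_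
  rw [Set.uIcc_of_le (by linarith)]
  exact Icc_mem_nhds (by linarith) (by linarith)

lemma AssumptionIII.indep {ξ : ℕ → Ω → ℝ} (h : AssumptionIII ξ P) : iIndepFun ξ P := by
  obtain ⟨lam, -, hlam, hind, -⟩ := h
  convert! iIndepFun_const_mul hind lam using 2 with k
  exact funext fun ω => (mul_div_cancel₀ _ (hlam k).ne').symm

lemma AssumptionIII.volume_absolutelyContinuous {ξ : ℕ → Ω → ℝ} (h : AssumptionIII ξ P)
    (hξ : ∀ k, Measurable (ξ k)) (k : ℕ) : volume ≪ P.map (ξ k) := by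
  obtain ⟨lam, φ, hlam, -, hlaw, hφ0, hφ, -⟩ := h
  have hscaled : volume ≪ P.map fun ω => ξ k ω / lam k := by
    rw [hlaw]
    refine withDensity_absolutelyContinuous' (continuous_of_absolutelyContinuousOnInterval
      hφ).measurable.ennreal_ofReal.aemeasurable (hφ0.mono fun x hx => ?_)
    exact (ENNReal.ofReal_pos.2 hx).ne'
  have hunscale : P.map (ξ k) = (P.map fun ω => ξ k ω / lam k).map (lam k * ·) := by
    rw [Measure.map_map (measurable_const_mul _) ((hξ k).div_const _)]
    congr 1
    exact funext fun ω => (mul_div_cancel₀ _ (hlam k).ne').symm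
  rw [hunscale]
  refine Measure.AbsolutelyContinuous.trans ?_ (hscaled.map (measurable_const_mul _))
  rw [Real.map_volume_mul_left (hlam k).ne']
  exact Measure.absolutelyContinuous_smul
    (ENNReal.ofReal_pos.2 (abs_pos.2 (inv_pos.2 (hlam k)).ne')).ne'

lemma AssumptionIII.assumptionI {X : Ω → E} (h : AssumptionIII (fun k ω => t k (X ω)) P)
    (hX : Measurable X) (ht : ∀ k, Measurable (t k)) (a : E) : AssumptionI t (P.map X) a := by
  have hpos : ∀ k, ∀ I : Set ℝ, MeasurableSet I → volume I ≠ 0 → 0 < P.map X (t k ⁻¹' I) := by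
    intro k I hI hI0
    rw [← Measure.map_apply (ht k) hI, Measure.map_map (ht k) hX, pos_iff_ne_zero]
    exact fun h0 => hI0 (h.volume_absolutelyContinuous (fun k => (ht k).comp hX) k h0)
  refine assumptionI_of_forall_measure_pos ht (iIndepFun_map_of_comp hX ht h.indep)
    (fun k => hpos k (Set.Ici (t k a)) measurableSet_Ici ?_)
    fun k => hpos k (Set.Iic (t k a)) measurableSet_Iic ?_
  · rw [Real.volume_Ici]
    exact ENNReal.top_ne_zero
  · rw [Real.volume_Iic]
    exact ENNReal.top_ne_zero

end Assumptions

section PopulationDepth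

lemma eventually_forall_sum_Ico_le_of_summable {f : ℕ → ℝ} (hf : Summable f) {ε : ℝ} (hε : 0 < ε) :
    ∀ᶠ d in atTop, ∀ N, ∑ k ∈ Finset.Ico d N, f k ≤ ε := by
  obtain ⟨s, hs⟩ := hf.vanishing (Iio_mem_nhds hε)
  obtain ⟨d₀, hd₀⟩ := s.exists_nat_subset_range
  filter_upwards [eventually_ge_atTop d₀] with d hd N
  refine (hs _ (Finset.disjoint_left.2 fun k hk hks => ?_)).le
  exact (hd.trans (Finset.mem_Ico.1 hk).1).not_gt (Finset.mem_range.1 (hd₀ hks))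

lemma tendsto_zero_of_summable_sq {f : ℕ → ℝ} (hf : Summable fun k => f k ^ 2) :
    Tendsto f atTop (𝓝 0) := by
  refine (tendsto_zero_iff_abs_tendsto_zero f).2 ?_
  simpa only [Real.sqrt_sq_eq_abs, Real.sqrt_zero, Function.comp_def] using
    hf.tendsto_atTop_zero.sqrt

variable {E : Type*} [MeasurableSpace E] {μ : Measure E}

lemma sq_le_measureReal_sum_mul_ge {ι : Type*} [Fintype ι] {X : ι → E → ℝ}
    (hX : ∀ k, Measurable (X k)) (hind : iIndepFun X μ) (hX2 : ∀ k, MemLp (X k) 2 μ)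
    (h0 : ∀ k, ∫ x, X k x ∂μ = 0) {σ : ι → ℝ} (hσ0 : ∀ k, 0 < σ k)
    (hσ : ∀ k, variance (X k) μ = σ k ^ 2) {c : ℝ} (hc0 : 0 ≤ c) (hc1 : c ≤ 1)
    (hc : ∀ k, c * σ k ≤ ∫ x, |X k x| ∂μ) {b : ι → ℝ}
    (hb : ∑ k, b k ^ 2 / σ k ^ 2 ≤ (c / 16) ^ 2) (α : ι → ℝ) :
    (c / 16) ^ 2 ≤ μ.real {x | ∑ k, α k * b k ≤ ∑ k, α k * X k x} := by
  have := hind.isProbabilityMeasure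
  have hvar : ∀ k, variance (fun x => α k * X k x) μ = (α k * σ k) ^ 2 := fun k => by
    rw [variance_const_mul, hσ, mul_pow]
  have hmean : ∀ k, c ^ 2 * variance (fun x => α k * X k x) μ ≤ (∫ x, |α k * X k x| ∂μ) ^ 2 := by
    intro k
    simp only [hvar, abs_mul, integral_const_mul]
    calc c ^ 2 * (α k * σ k) ^ 2 = |α k| ^ 2 * (c * σ k) ^ 2 := by rw [sq_abs]; ring
      _ ≤ |α k| ^ 2 * (∫ x, |X k x| ∂μ) ^ 2 := mul_le_mul_of_nonneg_left
          (pow_le_pow_left₀ (mul_nonneg hc0 (hσ0 k).le) (hc k) 2) (sq_nonneg _)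
      _ = _ := (mul_pow _ _ _).symm
  have hcauchy : ∑ k, α k * b k ≤ c / 16 * √(∑ k, variance (fun x => α k * X k x) μ) := by
    simp only [hvar]
    calc ∑ k, α k * b k = ∑ k, α k * σ k * (b k / σ k) :=
          Finset.sum_congr rfl fun k _ => by rw [mul_assoc, mul_div_cancel₀ _ (hσ0 k).ne']
      _ ≤ √(∑ k, (α k * σ k) ^ 2) * √(∑ k, (b k / σ k) ^ 2) :=
          Real.sum_mul_le_sqrt_mul_sqrt _ _ _
      _ ≤ √(∑ k, (α k * σ k) ^ 2) * (c / 16) := by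
          refine mul_le_mul_of_nonneg_left (Real.sqrt_le_iff.2 ⟨by positivity, ?_⟩)
            (Real.sqrt_nonneg _)
          simpa only [div_pow] using hb
      _ = _ := mul_comm _ _
  exact (sq_le_measureReal_sum_ge (fun k => (hX k).const_mul (α k))
    (iIndepFun_const_mul hind α) (fun k => (hX2 k).const_mul (α k))
    (fun k => by rw [integral_const_mul, h0, mul_zero]) hc0 hc1 hmean).trans
    (measureReal_mono fun x hx => hcauchy.trans hx)

lemma indepFun_sum_sum_of_disjoint {ι : Type*} {X : ι → E → ℝ} (hX : ∀ k, Measurable (X k))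
    (hind : iIndepFun X μ) {S T : Finset ι} (hST : Disjoint S T) :
    IndepFun (fun x => ∑ k ∈ S, X k x) (fun x => ∑ k ∈ T, X k x) μ := by
  have hsum : ∀ U : Finset ι, Measurable fun v : U → ℝ => ∑ k, v k := fun U =>
    Finset.measurable_sum _ fun k _ => measurable_pi_apply k
  convert! (hind.indepFun_finset S T hST hX).comp (hsum S) (hsum T) using 2 with x x
  · exact (Finset.sum_coe_sort S fun k => X k x).symm
  · exact (Finset.sum_coe_sort T fun k => X k x).symm

lemma measure_sum_range_ge_mul_measure_sum_Ico_ge_le {X : ℕ → E → ℝ} (hX : ∀ k, Measurable (X k))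
    (hind : iIndepFun X μ) (b : ℕ → ℝ) {d N : ℕ} (hdN : d ≤ N) :
    μ {x | ∑ k ∈ Finset.range d, b k ≤ ∑ k ∈ Finset.range d, X k x} *
        μ {x | ∑ k ∈ Finset.Ico d N, b k ≤ ∑ k ∈ Finset.Ico d N, X k x} ≤
      μ {x | ∑ k ∈ Finset.range N, b k ≤ ∑ k ∈ Finset.range N, X k x} := by
  have hdisj : Disjoint (Finset.range d) (Finset.Ico d N) :=
    Finset.disjoint_left.2 fun k hk hk' =>
      (Finset.mem_range.1 hk).not_ge (Finset.mem_Ico.1 hk').1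
  refine ((indepFun_sum_sum_of_disjoint hX hind hdisj).measure_inter_preimage_eq_mul
    (Set.Ici (∑ k ∈ Finset.range d, b k)) (Set.Ici (∑ k ∈ Finset.Ico d N, b k))
    measurableSet_Ici measurableSet_Ici).symm.trans_le (measure_mono fun x hx => ?_)
  rw [Set.mem_ofPred, ← Finset.sum_range_add_sum_Ico _ hdN, ← Finset.sum_range_add_sum_Ico _ hdN]
  exact add_le_add hx.1 hx.2

variable {t : ℕ → E → ℝ} {a : E} {σ : ℕ → ℝ}

theorem depth_finiteCombinations_pos_of_summable (hI : AssumptionI t μ a)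
    (ht : ∀ k, Measurable (t k)) (hind : iIndepFun t μ) (ht2 : ∀ k, MemLp (t k) 2 μ)
    (h0 : ∀ k, ∫ x, t k x ∂μ = 0) (hσ0 : ∀ k, 0 < σ k)
    (hσ : ∀ k, variance (t k) μ = σ k ^ 2) {c : ℝ} (hc0 : 0 < c) (hc1 : c ≤ 1)
    (hc : ∀ᶠ k in atTop, c * σ k ≤ ∫ x, |t k x| ∂μ)
    (hsum : Summable fun k => t k a ^ 2 / σ k ^ 2) :
    0 < depth (finiteCombinations t) a μ := by
  have := hind.isProbabilityMeasure
  have hε : 0 < (c / 16) ^ 2 := by positivity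
  obtain ⟨d, hd1, hdsum, hdc⟩ := ((eventually_ge_atTop 1).and
    ((eventually_forall_sum_Ico_le_of_summable hsum hε).and
      (eventually_forall_ge_atTop.2 hc))).exists
  obtain ⟨h, hh0, hhead⟩ := hI.exists_le_measure_sum_range_ge ht hd1
  have htail : ∀ (N : ℕ) (α : ℕ → ℝ), ENNReal.ofReal ((c / 16) ^ 2) ≤
      μ {x | ∑ k ∈ Finset.Ico d N, α k * t k a ≤ ∑ k ∈ Finset.Ico d N, α k * t k x} := by
    intro N α
    simp only [← Finset.sum_coe_sort (Finset.Ico d N)]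
    refine (ENNReal.ofReal_le_iff_le_toReal (measure_ne_top _ _)).2 (sq_le_measureReal_sum_mul_ge
      (X := fun k : Finset.Ico d N => t k)
      (fun k => ht k) (hind.precomp Subtype.val_injective) (fun k => ht2 k) (fun k => h0 k)
      (fun k => hσ0 k) (fun k => hσ k) hc0.le hc1
      (fun k => hdc k (Finset.mem_Ico.1 k.2).1) ?_ fun k => α k)
    exact (Finset.sum_coe_sort (Finset.Ico d N) fun k => t k a ^ 2 / σ k ^ 2).trans_le (hdsum N)
  refine (ENNReal.mul_pos hh0.ne' (ENNReal.ofReal_pos.2 hε).ne').trans_le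
    (le_iInf₂ fun τ hτ => ?_)
  obtain ⟨N, hdN, α, rfl⟩ := exists_eq_sum_range_of_mem_finiteCombinations hτ d
  exact (mul_le_mul' (hhead α) (htail N α)).trans
    (measure_sum_range_ge_mul_measure_sum_Ico_ge_le (fun k => (ht k).const_mul (α k))
      (iIndepFun_const_mul hind α) _ hdN)

lemma depth_finiteCombinations_le_inv_sum (hind : iIndepFun t μ)
    (ht2 : ∀ k, MemLp (t k) 2 μ) (h0 : ∀ k, ∫ x, t k x ∂μ = 0) (hσ0 : ∀ k, 0 < σ k)
    (hσ : ∀ k, variance (t k) μ = σ k ^ 2) {s : Finset ℕ}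
    (hs : 0 < ∑ k ∈ s, t k a ^ 2 / σ k ^ 2) :
    depth (finiteCombinations t) a μ ≤ ENNReal.ofReal (∑ k ∈ s, t k a ^ 2 / σ k ^ 2)⁻¹ := by
  have := hind.isProbabilityMeasure
  set v : ℝ := ∑ k ∈ s, t k a ^ 2 / σ k ^ 2
  -- Among all weights, `t k a / σ k ^ 2` maximizes the value at `a` relative to the variance.
  set w : ℕ → ℝ := fun k => t k a / σ k ^ 2 with hw
  have hwa : ∑ k ∈ s, w k * t k a = v := Finset.sum_congr rfl fun k _ => by
    rw [hw, div_mul_eq_mul_div, ← sq]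
  have hw2 : ∀ k, MemLp (fun x => w k * t k x) 2 μ := fun k => (ht2 k).const_mul _
  have hmean : ∫ x, ∑ k ∈ s, w k * t k x ∂μ = 0 := by
    rw [integral_finsetSum _ fun k _ => (hw2 k).integrable one_le_two]
    exact Finset.sum_eq_zero fun k _ => by rw [integral_const_mul, h0, mul_zero]
  have hvar : variance (fun x => ∑ k ∈ s, w k * t k x) μ = v := by
    rw [variance_sum_of_iIndepFun (iIndepFun_const_mul hind w) hw2]
    refine Finset.sum_congr rfl fun k _ => ?_
    have := (hσ0 k).ne'
    rw [variance_const_mul, hσ, hw]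
    field_simp
  have hcheb := meas_ge_le_variance_div_sq (memLp_finsetSum s fun k _ => hw2 k) hs
  rw [hvar, hmean, sq, div_mul_cancel_left₀ hs.ne'] at hcheb
  refine (iInf₂_le _ (sum_mem_finiteCombinations t s w)).trans ((measure_mono fun x hx => ?_).trans
    hcheb)
  rw [Set.mem_ofPred, sub_zero, ← hwa]
  exact le_trans hx (le_abs_self _)

theorem depth_finiteCombinations_eq_zero_of_not_summable (hind : iIndepFun t μ)
    (ht2 : ∀ k, MemLp (t k) 2 μ) (h0 : ∀ k, ∫ x, t k x ∂μ = 0) (hσ0 : ∀ k, 0 < σ k)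
    (hσ : ∀ k, variance (t k) μ = σ k ^ 2)
    (hsum : ¬ Summable fun k => t k a ^ 2 / σ k ^ 2) :
    depth (finiteCombinations t) a μ = 0 := by
  have htop : Tendsto (fun n => ∑ k ∈ Finset.range n, t k a ^ 2 / σ k ^ 2) atTop atTop :=
    (not_summable_iff_tendsto_nat_atTop_of_nonneg fun k => by positivity).1 hsum
  have hinv := ENNReal.tendsto_ofReal (tendsto_inv_atTop_zero.comp htop)
  rw [ENNReal.ofReal_zero] at hinv
  exact le_antisymm (ge_of_tendsto hinv ((htop.eventually_gt_atTop 0).mono fun n hn =>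
    depth_finiteCombinations_le_inv_sum hind ht2 h0 hσ0 hσ hn)) zero_le

end PopulationDepth

section EmpiricalDepth

variable {E Ω : Type*} [MeasurableSpace E] [MeasurableSpace Ω] {P : Measure Ω} {μ : Measure E}
  {Xs : ℕ → Ω → E} (hXs : ∀ j, Measurable (Xs j)) (hindep : iIndepFun Xs P)
  (hlaw : ∀ j, P.map (Xs j) = μ)

include hXs hindep hlaw

lemma measure_biInter_preimage_eq_pow {C : Set E} (hC : MeasurableSet C) (n : ℕ) :
    P (⋂ j ∈ Finset.range n, Xs j ⁻¹' C) = μ C ^ n := by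
  rw [hindep.meas_biInter fun j _ => ⟨C, hC, rfl⟩]
  simp only [← Measure.map_apply (hXs _) hC, hlaw, Finset.prod_const, Finset.card_range]

lemma iIndepSet_biInter_preimage {D : ℕ → Set E} (hD : ∀ k, MeasurableSet (D k))
    (hDind : iIndepSet D μ) (n : ℕ) :
    iIndepSet (fun k => ⋂ j ∈ Finset.range n, Xs j ⁻¹' D k) P := by
  have hpow := fun {C : Set E} (hC : MeasurableSet C) =>
    measure_biInter_preimage_eq_pow hXs hindep hlaw hC n
  rw [iIndepSet_iff_meas_biInter fun k =>
    Finset.measurableSet_biInter _ fun j _ => hXs j (hD k)]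
  intro s
  have hswap : ⋂ k ∈ s, ⋂ j ∈ Finset.range n, Xs j ⁻¹' D k =
      ⋂ j ∈ Finset.range n, Xs j ⁻¹' ⋂ k ∈ s, D k := by
    simp only [Set.preimage_iInter]
    exact Set.iInter₂_comm _
  rw [hswap, hpow (Finset.measurableSet_biInter _ fun k _ => hD k), hDind.meas_biInter,
    ← Finset.prod_pow]
  exact Finset.prod_congr rfl fun k _ => (hpow (hD k)).symm

lemma ae_exists_forall_mem_of_liminf_pos {D : ℕ → Set E} (hD : ∀ k, MeasurableSet (D k))
    (hDind : iIndepSet D μ) (hlim : 0 < liminf (fun k => μ (D k)) atTop) (n : ℕ) :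
    ∀ᵐ ω ∂P, ∃ k, ∀ j < n, Xs j ω ∈ D k := by
  have := hindep.isProbabilityMeasure
  set A : ℕ → Set Ω := fun k => ⋂ j ∈ Finset.range n, Xs j ⁻¹' D k
  have hA : ∀ k, MeasurableSet (A k) := fun k =>
    Finset.measurableSet_biInter _ fun j _ => hXs j (hD k)
  obtain ⟨δ, hδ0, hδ⟩ := exists_between hlim
  have hδA : ∀ᶠ k in atTop, δ ^ n ≤ P (A k) :=
    (eventually_lt_of_lt_liminf hδ).mono fun k hk => by
      rw [measure_biInter_preimage_eq_pow hXs hindep hlaw (hD k)]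
      exact pow_le_pow_left' hk.le n
  have hsum : ∑' k, P (A k) = ∞ := by
    by_contra hne
    exact (ENNReal.pow_pos hδ0 n).not_ge
      (ge_of_tendsto (ENNReal.tendsto_atTop_zero_of_tsum_ne_top hne) hδA)
  have hlimsup : ∀ᵐ ω ∂P, ω ∈ limsup A atTop :=
    (prob_compl_eq_zero_iff (.measurableSet_limsup hA)).2
      (measure_limsup_eq_one hA (iIndepSet_biInter_preimage hXs hindep hlaw hD hDind n) hsum)
  filter_upwards [hlimsup] with ω hω
  obtain ⟨k, hk⟩ := (mem_limsup_iff_frequently_mem.1 hω).exists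
  exact ⟨k, fun j hj => Set.mem_iInter₂.1 hk j (Finset.mem_range.2 hj)⟩

theorem ae_forall_depth_empiricalMeasure_eq_zero {T : Set (E → ℝ)} {a : E} {t : ℕ → E → ℝ}
    (htT : ∀ k, t k ∈ T) (ht : ∀ k, Measurable (t k)) (htind : iIndepFun t μ)
    (hlim : 0 < liminf (fun k => μ {x | t k x < t k a}) atTop) :
    ∀ᵐ ω ∂P, ∀ n, depth T a (empiricalMeasure (fun j => Xs j ω) n) = 0 := by
  have hD : ∀ k, MeasurableSet {x | t k x < t k a} := fun k =>
    measurableSet_lt (ht k) measurable_const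
  have hDind : iIndepSet (fun k => {x | t k x < t k a}) μ := by
    rw [iIndepSet_iff_meas_biInter hD]
    exact fun s => htind.meas_biInter fun k _ => ⟨Set.Iio (t k a), measurableSet_Iio, rfl⟩
  filter_upwards [ae_all_iff.2 (ae_exists_forall_mem_of_liminf_pos hXs hindep hlaw hD hDind hlim)]
    with ω hω n
  obtain ⟨k, hk⟩ := hω n
  exact depth_empiricalMeasure_eq_zero (htT k) (ht k) hk

end EmpiricalDepth

end HalfSpaceDepth

open HalfSpaceDepth in
theorem corollary1_general
    {B : Type*} [MeasurableSpace B]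
    {Ω : Type*} [MeasurableSpace Ω] (P : Measure Ω)
    (X : Ω → B) (hX : Measurable X)
    (Xs : ℕ → Ω → B) (hXs : ∀ j, Measurable (Xs j))
    (hXs_indep : iIndepFun Xs P) (hXs_ident : ∀ j, IdentDistrib (Xs j) X P P)
    (t : ℕ → B → ℝ) (ht : ∀ k, Measurable (t k))
    (ht_indep : iIndepFun (fun k ω => t k (X ω)) P)
    (ht_memLp : ∀ k, MemLp (fun ω => t k (X ω)) 2 P)
    (ht_mean : ∀ k, ∫ ω, t k (X ω) ∂P = 0)
    (σ : ℕ → ℝ) (hσ_pos : ∀ k, 0 < σ k)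
    (hσ : ∀ k, variance (fun ω => t k (X ω)) P = σ k ^ 2)
    (hliminf : ∀ c : ℕ → ℝ, Tendsto (fun k => c k / σ k) atTop (𝓝 0) →
      0 < liminf (fun k => P {ω | t k (X ω) < c k}) atTop)
    (a : B)
    (hI : AssumptionI t (P.map X) a) :
    (Summable (fun k => t k a ^ 2 / σ k ^ 2) →
      (∀ᵐ ω ∂P, ∀ n : ℕ, 1 ≤ n →
        depth (finiteCombinations t) a (empiricalMeasure (fun j => Xs j ω) n) = 0) ∧
      0 < depth (finiteCombinations t) a (P.map X) ∧
      (∀ᵐ ω ∂P, ¬ Tendsto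
        (fun n => depth (finiteCombinations t) a (empiricalMeasure (fun j => Xs j ω) n))
        atTop (𝓝 (depth (finiteCombinations t) a (P.map X))))) ∧
    (¬ Summable (fun k => t k a ^ 2 / σ k ^ 2) →
      Tendsto (fun k => t k a / σ k) atTop (𝓝 0) →
      ∀ᵐ ω ∂P, Tendsto
        (fun n => depth (finiteCombinations t) a (empiricalMeasure (fun j => Xs j ω) n))
        atTop (𝓝 (depth (finiteCombinations t) a (P.map X)))) := by
  have hind : iIndepFun t (P.map X) := iIndepFun_map_of_comp hX ht ht_indep
  have ht2 : ∀ k, MemLp (t k) 2 (P.map X) := fun k =>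
    (memLp_map_measure_iff (ht k).aestronglyMeasurable hX.aemeasurable).2 (ht_memLp k)
  have ht0 : ∀ k, ∫ x, t k x ∂P.map X = 0 := fun k => by
    rw [integral_map hX.aemeasurable (ht k).aestronglyMeasurable, ht_mean]
  have htσ : ∀ k, variance (t k) (P.map X) = σ k ^ 2 := fun k => by
    rw [variance_map (ht k).aemeasurable hX.aemeasurable]
    exact hσ k
  have hliminf_map : ∀ c : ℕ → ℝ, Tendsto (fun k => c k / σ k) atTop (𝓝 0) →
      0 < liminf (fun k => P.map X {x | t k x < c k}) atTop := fun c hc => by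
    simp only [Measure.map_apply hX (measurableSet_lt (ht _) measurable_const)]
    exact hliminf c hc
  have := hind.isProbabilityMeasure
  have hempirical (hta : Tendsto (fun k => t k a / σ k) atTop (𝓝 0)) :=
    ae_forall_depth_empiricalMeasure_eq_zero hXs hXs_indep (fun j => (hXs_ident j).map_eq)
      (mem_finiteCombinations t) ht hind (hliminf_map _ hta)
  refine ⟨fun hsum => ?_, fun hsum hta => ?_⟩
  · obtain ⟨c, hc0, hc1, hc⟩ := exists_eventually_mul_le_integral_abs_of_liminf_pos
      (fun k => (ht2 k).integrable one_le_two) hσ_pos hliminf_map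
    have hpos := depth_finiteCombinations_pos_of_summable hI ht hind ht2 ht0 hσ_pos htσ hc0 hc1 hc
      hsum
    have hzero := hempirical (tendsto_zero_of_summable_sq (by simpa only [div_pow] using hsum))
    refine ⟨hzero.mono fun ω hω n _ => hω n, hpos, hzero.mono fun ω hω hlim => hpos.ne' ?_⟩
    simp only [hω] at hlim
    exact tendsto_nhds_unique hlim tendsto_const_nhds
  · rw [depth_finiteCombinations_eq_zero_of_not_summable hind ht2 ht0 hσ_pos htσ hsum]
    filter_upwards [hempirical hta] with ω hω
    simp only [hω]
    exact tendsto_const_nhds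

open HalfSpaceDepth in
theorem corollary1
    -- `B` is a real F-space with its Borel sets
    {B : Type*} [AddCommGroup B] [Module ℝ B] [MetricSpace B] [CompleteSpace B]
    [ContinuousSMul ℝ B] (hinv : ∀ x y z : B, dist (x + z) (y + z) = dist x y)
    [MeasurableSpace B] [BorelSpace B]
    {Ω : Type*} [MeasurableSpace Ω] (P : Measure Ω) [IsProbabilityMeasure P]
    -- a random vector `X` and i.i.d. copies `Xs 0, Xs 1, …` of it
    (X : Ω → B) (hX : Measurable X)
    (Xs : ℕ → Ω → B) (hXs : ∀ j, Measurable (Xs j))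
    (hXs_indep : iIndepFun Xs P) (hXs_ident : ∀ j, IdentDistrib (Xs j) X P P)
    -- Borel functionals with `t k (X)` independent, of mean zero and variance `σ k ^ 2` in `(0, ∞)`
    (t : ℕ → B → ℝ) (ht : ∀ k, Measurable (t k))
    (ht_indep : iIndepFun (fun k ω => t k (X ω)) P)
    (ht_memLp : ∀ k, MemLp (fun ω => t k (X ω)) 2 P)
    (ht_mean : ∀ k, ∫ ω, t k (X ω) ∂P = 0)
    (σ : ℕ → ℝ) (hσ_pos : ∀ k, 0 < σ k)
    (hσ : ∀ k, variance (fun ω => t k (X ω)) P = σ k ^ 2)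
    (hliminf : ∀ c : ℕ → ℝ, Tendsto (fun k => c k / σ k) atTop (𝓝 0) →
      0 < liminf (fun k => P {ω | t k (X ω) < c k}) atTop)
    (a : B)
    (hA : (AssumptionI t (P.map X) a ∧ AssumptionII (fun k ω => t k (X ω)) P) ∨
      AssumptionIII (fun k ω => t k (X ω)) P) :
    (Summable (fun k => t k a ^ 2 / σ k ^ 2) →
      (∀ᵐ ω ∂P, ∀ n : ℕ, 1 ≤ n →
        depth (finiteCombinations t) a (empiricalMeasure (fun j => Xs j ω) n) = 0) ∧
      0 < depth (finiteCombinations t) a (P.map X) ∧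
      (∀ᵐ ω ∂P, ¬ Tendsto
        (fun n => depth (finiteCombinations t) a (empiricalMeasure (fun j => Xs j ω) n))
        atTop (𝓝 (depth (finiteCombinations t) a (P.map X))))) ∧
    (¬ Summable (fun k => t k a ^ 2 / σ k ^ 2) →
      Tendsto (fun k => t k a / σ k) atTop (𝓝 0) →
      ∀ᵐ ω ∂P, Tendsto
        (fun n => depth (finiteCombinations t) a (empiricalMeasure (fun j => Xs j ω) n))
        atTop (𝓝 (depth (finiteCombinations t) a (P.map X)))) :=
  corollary1_general P X hX Xs hXs hXs_indep hXs_ident t ht ht_indep ht_memLp ht_mean σ hσ_pos hσ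
    hliminf a (hA.elim And.left fun hIII => hIII.assumptionI hX ht a)
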